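/- Let $r>0$, $L>0$ and $k_I\in\mathbb R$. Consider the linear closed-loop system $$\phi_t(x,t)=-r\,\phi_x(x,t)\ \ (0<x<L,\ t>0),\qquad \dot\xi(t)=\phi(L,t),\qquad \phi(0,t)=-k_I\,\xi(t),$$ $$\phi(\cdot,0)=\phi_0,\qquad \xi(0)=\xi_0,$$ in the Hilbert space $Z=L^2(0,L)\times\mathbb R$ with norm $\|(\phi,\xi)\|_Z^2=\int_0^L\phi(x)^2\,dx+\xi^2$. Solutions are understood in the mild sense: with $A(\phi,\xi)=(-r\phi',\phi(L))$ on the domain $D(A)=\{(\phi,\xi)\in H^1(0,L)\times\mathbb R:\ \phi(0)=-k_I\xi\}$, a solution with initial state $z_0=(\phi_0,\xi_0)\in Z$ is a $z=(\phi,\xi)\in C([0,\infty);Z)$ with $z(0)=z_0$ such that $\int_0^t z(s)\,ds\in D(A)$ and $z(t)-z_0=A\int_0^t z(s)\,ds$ for every $t\ge 0$. Then for every $z_0\in Z$ there is exactly one solution on $[0,\infty)$. Moreover, the system is exponentially stable in $Z$, that is, there exist constants $M>0$ and $\omega>0$ such that $$\|(\phi(\cdot,t),\xi(t))\|_Z\le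 M e^{-\omega t}\,\|(\phi_0,\xi_0)\|_Z\qquad\text{for all } t\ge 0 \text{ and all } (\phi_0,\xi_0)\in Z,$$ if and only if $k_I\in\left(0,\dfrac{r\pi}{2L}\right)$. -/

import Mathlib

open MeasureTheory Set

namespace TransportIntegral

/-- The state space `Z = L²(0, L) × ℝ` with the Hilbert norm
`‖(φ, ξ)‖² = ∫₀ᴸ φ(x)² dx + ξ²`. -/
abbrev StateSpace (L : ℝ) : Type :=
  WithLp 2 (Lp ℝ 2 (volume.restrict (Ioo 0 L)) × ℝ)

/-- The graph of the closed-loop operator `A (φ, ξ) = (-r φ', φ(L))` in `Z`, whose domain consists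
of the `(φ, ξ)` with `φ ∈ H¹(0, L)` and `φ(0) = -k ξ`. The statement `GeneratorGraph r L k w v`
says that `w` is in the domain and `A w = v`. Here `f` is the absolutely continuous representative
of the first component of `w`; its derivative is square integrable because the first component of
`v` is. -/
def GeneratorGraph (r L k : ℝ) (w v : StateSpace L) : Prop :=
  ∃ f : ℝ → ℝ, AbsolutelyContinuousOnInterval f 0 L ∧
    (∀ᵐ x ∂(volume.restrict (Ioo 0 L)), w.fst x = f x) ∧
    (∀ᵐ x ∂(volume.restrict (Ioo 0 L)), v.fst x = -r * deriv f x) ∧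
    f 0 = -k * w.snd ∧
    v.snd = f L

/-- `z t = (φ(·, t), ξ(t))` is a (mild) solution on `[0, ∞)` in `C([0, ∞); Z)` of
`φ_t = -r φ_x`, `ξ' = φ(L, t)`, `φ(0, t) = -k ξ`, with initial state `z₀ = (φ₀, ξ₀)`:
`∫₀ᵗ z(s) ds` is in the domain of `A` and `A (∫₀ᵗ z(s) ds) = z(t) - z₀` for all `t ≥ 0`.
Values of `z` at negative times are irrelevant. -/
structure IsSolution (r L k : ℝ) (z₀ : StateSpace L) (z : ℝ → StateSpace L) : Prop where
  continuousOn : ContinuousOn z (Ici 0)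
  initial : z 0 = z₀
  evolution : ∀ t : ℝ, 0 ≤ t → GeneratorGraph r L k (∫ s in (0 : ℝ)..t, z s) (z t - z₀)

/-- The Cauchy problem has exactly one solution on `[0, ∞)` for every initial state in `Z`. -/
def WellPosed (r L k : ℝ) : Prop :=
  ∀ z₀ : StateSpace L,
    (∃ z : ℝ → StateSpace L, IsSolution r L k z₀ z) ∧
    ∀ z₁ z₂ : ℝ → StateSpace L, IsSolution r L k z₀ z₁ → IsSolution r L k z₀ z₂ →
      EqOn z₁ z₂ (Ici 0)

/-- Exponential stability in `Z`: `‖z(t)‖ ≤ M e^{-ω t} ‖z₀‖` for all `t ≥ 0`, with `M, ω > 0`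
independent of the initial state. -/
def ExponentiallyStable (r L k : ℝ) : Prop :=
  ∃ M : ℝ, 0 < M ∧ ∃ ω : ℝ, 0 < ω ∧
    ∀ (z₀ : StateSpace L) (z : ℝ → StateSpace L), IsSolution r L k z₀ z →
      ∀ t : ℝ, 0 ≤ t → ‖z t‖ ≤ M * Real.exp (-ω * t) * ‖z₀‖

end TransportIntegral

open Filter Topology

namespace TransportIntegral

/-! The distributed state is carried along characteristics: φ(x, t) = p(x - r t), where p(-r t) = -k
ξ(t) encodes the boundary condition. After the transit time τ = L / r the integrator therefore obeys
the scalar delay equation ξ'(t) = -k ξ(t - τ), and both existence and stability reduce to it.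
Existence is the method of steps (`exists_delay_solution`); uniqueness holds because A is
dissipative up to a multiple of the identity (`GeneratorGraph.inner_le`).

For decay, successive segments of ξ of length τ are iterates of the operator sending f to t ↦ f(τ) -
k ∫₀ᵗ f on C([0, τ]). Its nonzero spectral values satisfy μ = exp(-kτ/μ) (`mem_spectrum_delayStep`).
If 0 < kτ < π/2 they lie in the open unit disc (`norm_lt_one_of_eq_exp`), so Gelfand's formula gives
geometric decay of ξ, and `norm_state_sq_le` transfers it to Z. For all other k, the equation λ + k
exp(-λτ) = 0 has a root with Re λ ≥ 0, and the real part of exp(λt) is an integrator state that does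
not tend to 0. -/

/-! ### Uniqueness by an energy estimate -/

theorem GeneratorGraph.sub {r L k : ℝ} {w₁ v₁ w₂ v₂ : StateSpace L} (hL : 0 < L)
    (h₁ : GeneratorGraph r L k w₁ v₁) (h₂ : GeneratorGraph r L k w₂ v₂) :
    GeneratorGraph r L k (w₁ - w₂) (v₁ - v₂) := by
  obtain ⟨f, hf, hfw, hfv, hf0, hfL⟩ := h₁
  obtain ⟨g, hg, hgw, hgv, hg0, hgL⟩ := h₂
  refine ⟨f - g, hf.sub hg, ?_, ?_, ?_, ?_⟩
  · filter_upwards [hfw, hgw, Lp.coeFn_sub w₁.fst w₂.fst] with x h1 h2 h3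
    simp only [WithLp.sub_fst, h3, Pi.sub_apply, h1, h2]
  · filter_upwards [hfv, hgv, Lp.coeFn_sub v₁.fst v₂.fst,
      ae_restrict_of_ae hf.ae_differentiableAt, ae_restrict_of_ae hg.ae_differentiableAt,
      ae_restrict_mem measurableSet_Ioo] with x h1 h2 h3 hdf hdg hx
    have hx' : x ∈ uIcc 0 L := by rw [uIcc_of_le hL.le]; exact Ioo_subset_Icc_self hx
    rw [deriv_sub (hdf hx') (hdg hx')]
    simp only [WithLp.sub_fst, h3, Pi.sub_apply, h1, h2]
    ring
  · simp [hf0, hg0]; ring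
  · simp [hfL, hgL]

/-- Dissipation up to a lower-order term: integrating by parts, the boundary term at `x = L`
absorbs the coupling of `φ(L)` with `ξ`. -/
theorem GeneratorGraph.inner_le {r L k : ℝ} {w v : StateSpace L} (hr : 0 < r) (hL : 0 < L)
    (h : GeneratorGraph r L k w v) :
    inner ℝ w v ≤ (r * k ^ 2 / 2 + 1 / (2 * r)) * ‖w‖ ^ 2 := by
  obtain ⟨f, hf, hfw, hfv, hf0, hfL⟩ := h
  have key : inner ℝ w.fst v.fst = -r / 2 * (f L ^ 2 - f 0 ^ 2) := by
    rw [L2.inner_def]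
    have h1 : ∫ x in Ioo 0 L, inner ℝ (w.fst x) (v.fst x)
        = ∫ x in Ioo 0 L, -r / 2 * (deriv f x * f x + f x * deriv f x) := by
      apply integral_congr_ae
      filter_upwards [hfw, hfv] with x h1 h2
      simp only [h1, h2, RCLike.inner_apply, conj_trivial]
      ring
    rw [h1, ← integral_Ioc_eq_integral_Ioo, ← intervalIntegral.integral_of_le hL.le,
      intervalIntegral.integral_const_mul, hf.integral_deriv_mul_eq_sub hf]
    ring
  have hn : w.snd ^ 2 ≤ ‖w‖ ^ 2 := by
    rw [WithLp.prod_norm_sq_eq_of_L2, Real.norm_eq_abs, sq_abs]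
    nlinarith [sq_nonneg ‖w.fst‖]
  have hsnd : inner ℝ w.snd v.snd = w.snd * v.snd := by
    simp [mul_comm]
  have e : inner ℝ w v = inner ℝ w.fst v.fst + inner ℝ w.snd v.snd := WithLp.prod_inner_apply _ _
  rw [e, key, hsnd, hfL, hf0]
  have hC : 0 ≤ r * k ^ 2 / 2 + 1 / (2 * r) := by positivity
  refine le_trans ?_ (mul_le_mul_of_nonneg_left hn hC)
  -- The constant is the one for which completing the square in f(L) leaves exactly a square.
  have : (r * k ^ 2 / 2 + 1 / (2 * r)) * w.snd ^ 2 -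
      (-r / 2 * (f L ^ 2 - (-k * w.snd) ^ 2) + w.snd * f L) = (r * f L - w.snd) ^ 2 / (2 * r) := by
    field_simp
    ring
  have h2 : 0 ≤ (r * f L - w.snd) ^ 2 / (2 * r) := by positivity
  linarith

/-- Grönwall in energy form: exp(-2Ct) ‖w(t)‖² is nonincreasing on [0, ∞) and starts at 0. -/
theorem eq_zero_of_hasDerivAt_inner_le {E : Type*} [NormedAddCommGroup E]
    [InnerProductSpace ℝ E] {w w' : ℝ → E} {C : ℝ} (h0 : w 0 = 0)
    (hw : ∀ t, HasDerivAt w (w' t) t) (hle : ∀ t, 0 ≤ t → inner ℝ (w t) (w' t) ≤ C * ‖w t‖ ^ 2)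
    {t : ℝ} (ht : 0 ≤ t) : w t = 0 := by
  have hd : ∀ t, HasDerivAt (fun t => Real.exp (-(2 * C) * t) * ‖w t‖ ^ 2)
      (Real.exp (-(2 * C) * t) * (2 * inner ℝ (w t) (w' t) - 2 * C * ‖w t‖ ^ 2)) t := by
    intro t
    have h1 : HasDerivAt (fun t => Real.exp (-(2 * C) * t))
        (Real.exp (-(2 * C) * t) * (-(2 * C))) t := by
      simpa using ((hasDerivAt_id t).const_mul (-(2 * C))).exp
    refine (h1.mul (hw t).norm_sq).congr_deriv ?_
    ring
  have hanti : AntitoneOn (fun t => Real.exp (-(2 * C) * t) * ‖w t‖ ^ 2) (Ici 0) := by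
    apply antitoneOn_of_deriv_nonpos (convex_Ici 0)
    · exact fun t _ => (hd t).continuousAt.continuousWithinAt
    · exact fun t _ => (hd t).differentiableAt.differentiableWithinAt
    · intro t ht
      rw [interior_Ici] at ht
      rw [(hd t).deriv]
      have := hle t (le_of_lt ht)
      exact mul_nonpos_of_nonneg_of_nonpos (Real.exp_pos _).le (by linarith)
  have h1 := hanti (mem_Ici.2 le_rfl) (mem_Ici.2 ht) ht
  simp only [h0, norm_zero, ne_eq, two_ne_zero, not_false_eq_true, zero_pow, mul_zero] at h1
  have h2 : ‖w t‖ ^ 2 ≤ 0 := by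
    by_contra! hpos
    have := mul_pos (Real.exp_pos (-(2 * C) * t)) hpos
    linarith
  have h3 : ‖w t‖ = 0 := by
    have := sq_nonneg ‖w t‖
    exact pow_eq_zero_iff (two_ne_zero) |>.1 (le_antisymm h2 this)
  simpa using h3

/-- The difference of two mild solutions need not lie in the domain of A, but its time integral
does, and that integral is a differentiable solution of w' = A w with w(0) = 0. The energy estimate
kills w, and differentiating w kills the difference. -/
theorem IsSolution.eqOn {r L k : ℝ} (hr : 0 < r) (hL : 0 < L) {z₀ : StateSpace L}
    {z₁ z₂ : ℝ → StateSpace L} (h₁ : IsSolution r L k z₀ z₁) (h₂ : IsSolution r L k z₀ z₂) :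
    EqOn z₁ z₂ (Ici 0) := by
  -- Freezing the difference at negative times makes it continuous on the whole line, so its
  -- primitive is differentiable at every time, 0 included.
  set d : ℝ → StateSpace L := fun t => z₁ (max t 0) - z₂ (max t 0) with hd
  have hmax : ∀ s : ℝ, max s 0 ∈ Ici (0 : ℝ) := fun s => le_max_right s 0
  have hdc : Continuous d := by
    have hm : Continuous fun t : ℝ => max t 0 := by fun_prop
    exact (h₁.continuousOn.comp_continuous hm hmax).sub (h₂.continuousOn.comp_continuous hm hmax)
  have hgraph : ∀ t, 0 ≤ t → GeneratorGraph r L k (∫ s in (0 : ℝ)..t, d s) (d t) := by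
    intro t ht
    have hint : ∀ {z : ℝ → StateSpace L}, ContinuousOn z (Ici 0) →
        IntervalIntegrable z volume 0 t := fun hz =>
      (hz.mono (by rw [uIcc_of_le ht]; exact Icc_subset_Ici_self)).intervalIntegrable
    have e : ∫ s in (0 : ℝ)..t, d s = (∫ s in (0 : ℝ)..t, z₁ s) - ∫ s in (0 : ℝ)..t, z₂ s := by
      rw [← intervalIntegral.integral_sub (hint h₁.continuousOn) (hint h₂.continuousOn)]
      apply intervalIntegral.integral_congr
      intro s hs
      rw [uIcc_of_le ht] at hs
      simp only [hd, max_eq_left hs.1]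
    have e' : d t = (z₁ t - z₀) - (z₂ t - z₀) := by simp [hd, max_eq_left ht]
    rw [e, e']
    exact (h₁.evolution t ht).sub hL (h₂.evolution t ht)
  have hderiv : ∀ t, HasDerivAt (fun t => ∫ s in (0 : ℝ)..t, d s) (d t) t := fun t =>
    intervalIntegral.integral_hasDerivAt_right (hdc.intervalIntegrable _ _)
      (hdc.stronglyMeasurableAtFilter _ _) hdc.continuousAt
  have hzero : ∀ t, 0 ≤ t → ∫ s in (0 : ℝ)..t, d s = 0 := fun t ht =>
    eq_zero_of_hasDerivAt_inner_le (by simp) hderiv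
      (fun t ht => (hgraph t ht).inner_le hr hL) ht
  intro t ht
  have h1 : HasDerivWithinAt (fun t => ∫ s in (0 : ℝ)..t, d s) 0 (Ici t) t :=
    (hasDerivWithinAt_const t (Ici t) (0 : StateSpace L)).congr
      (fun s hs => hzero s (le_trans ht hs)) (hzero t ht)
  have h2 := (uniqueDiffWithinAt_Ici t).eq_deriv _ h1 (hderiv t).hasDerivWithinAt
  have h3 : d t = z₁ t - z₂ t := by simp only [hd, max_eq_left (mem_Ici.1 ht)]
  rw [h3] at h2
  exact sub_eq_zero.1 h2.symm

/-! ### Trajectories along characteristics are mild solutions -/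

/-- A Bochner integral in `L²` is computed pointwise. -/
theorem coeFn_integral_ae_eq {S α : Type*} [MeasurableSpace S] [MeasurableSpace α]
    {ν : Measure S} [SFinite ν] {μ : Measure α} [IsFiniteMeasure μ] {F : S → Lp ℝ 2 μ}
    {G : S → α → ℝ} (hF : Integrable F ν) (hG : Integrable (Function.uncurry G) (ν.prod μ))
    (h : ∀ s, F s =ᵐ[μ] G s) :
    (∫ s, F s ∂ν : Lp ℝ 2 μ) =ᵐ[μ] fun x => ∫ s, G s x ∂ν := by
  -- Both sides are tested against indicators; the inner product commutes with the Bochner integral,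
  -- and Fubini does the rest.
  apply Integrable.ae_eq_of_forall_setIntegral_eq
  · exact (Lp.memLp _).integrable one_le_two
  · exact hG.integral_prod_right
  intro A hA _
  have hfin : μ A ≠ ⊤ := measure_ne_top μ A
  rw [← L2.inner_indicatorConstLp_one hA hfin, ← integral_inner hF]
  have e : ∀ s, inner ℝ (indicatorConstLp 2 hA hfin (1 : ℝ)) (F s) = ∫ x in A, G s x ∂μ := by
    intro s
    rw [L2.inner_indicatorConstLp_one hA hfin]
    exact integral_congr_ae (ae_restrict_of_ae (h s))
  simp_rw [e]
  apply integral_integral_swap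
  have : ν.prod (μ.restrict A) = (ν.prod μ).restrict (univ ×ˢ A) := by
    rw [← Measure.prod_restrict, Measure.restrict_univ]
  rw [this]
  exact hG.restrict

theorem intervalIntegrable_of_memLp_Ioi {p : ℝ → ℝ}
    (hp : ∀ a, MemLp p 2 (volume.restrict (Ioi a))) (a b : ℝ) : IntervalIntegrable p volume a b := by
  rw [intervalIntegrable_iff]
  have h1 : MemLp p 2 (volume.restrict (Ioc (min a b) (max a b))) :=
    (hp (min a b)).mono_measure (Measure.restrict_mono Ioc_subset_Ioi_self le_rfl)
  exact h1.integrable one_le_two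

theorem intervalIntegrable_comp_sub_mul_of_memLp_Ioi {p : ℝ → ℝ}
    (hp : ∀ a, MemLp p 2 (volume.restrict (Ioi a))) (r x a b : ℝ) :
    IntervalIntegrable (fun s => p (x - r * s)) volume a b := by
  have h1 := (intervalIntegrable_of_memLp_Ioi hp (x - r * a) (x - r * b)).comp_sub_left x
  rcases eq_or_ne r 0 with rfl | hr
  · simp
  · have h2 := h1.comp_mul_left (c := r)
    simpa [hr] using h2

/-- The pair `(p, X)` encodes a trajectory by the method of characteristics: the distributed state
at time `t` is `x ↦ p (x - r t)`, and the integrator state is `X t`. -/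
structure IsProfile (r L k : ℝ) (p X : ℝ → ℝ) : Prop where
  memLp : ∀ a, MemLp p 2 (volume.restrict (Ioi a))
  continuous : Continuous X
  boundary : ∀ t, 0 ≤ t → p (-(r * t)) = -k * X t
  integral : ∀ t, 0 ≤ t → X t = X 0 + ∫ s in (0 : ℝ)..t, p (L - r * s)

namespace IsProfile

variable {r L k : ℝ} {p X : ℝ → ℝ}

theorem memLp_indicator (h : IsProfile r L k p X) (a : ℝ) : MemLp ((Ioi a).indicator p) 2 volume :=
  (memLp_indicator_iff_restrict measurableSet_Ioi).2 (h.memLp a)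

theorem intervalIntegrable (h : IsProfile r L k p X) (a b : ℝ) : IntervalIntegrable p volume a b :=
  intervalIntegrable_of_memLp_Ioi h.memLp a b

theorem memLp_shift (h : IsProfile r L k p X) (c : ℝ) :
    MemLp (fun x => p (x - c)) 2 (volume.restrict (Ioo 0 L)) := by
  have h1 := ((h.memLp_indicator (-c)).comp_measurePreserving
    (measurePreserving_sub_right volume c)).restrict (Ioo 0 L)
  refine h1.ae_eq ?_
  filter_upwards [ae_restrict_mem measurableSet_Ioo] with x hx
  have : x - c ∈ Ioi (-c) := by simp only [mem_Ioi]; linarith [hx.1]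
  simp [Function.comp, indicator_of_mem this]

/-- The trajectory in the state space. -/
noncomputable def state (h : IsProfile r L k p X) (t : ℝ) : StateSpace L :=
  WithLp.toLp 2 ((h.memLp_shift (r * t)).toLp _, X t)

theorem state_snd (h : IsProfile r L k p X) (t : ℝ) : (h.state t).snd = X t := rfl

theorem coeFn_state_fst (h : IsProfile r L k p X) (t : ℝ) :
    (h.state t).fst =ᵐ[volume.restrict (Ioo 0 L)] fun x => p (x - r * t) :=
  (h.memLp_shift (r * t)).coeFn_toLp

theorem norm_state_sq (h : IsProfile r L k p X) (t : ℝ) :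
    ‖h.state t‖ ^ 2 = (∫ x in Ioo 0 L, p (x - r * t) ^ 2) + X t ^ 2 := by
  rw [WithLp.prod_norm_sq_eq_of_L2, state_snd, Real.norm_eq_abs, sq_abs,
    ← real_inner_self_eq_norm_sq, L2.inner_def]
  congr 1
  apply integral_congr_ae
  filter_upwards [h.coeFn_state_fst t] with x hx
  simp only [hx, RCLike.inner_apply, conj_trivial]
  ring

theorem continuous_state_fst (h : IsProfile r L k p X) (hr : 0 < r) :
    Continuous fun t => (h.state t).fst := by
  have hmp : ∀ t : ℝ, MeasurePreserving (fun x : ℝ => x - r * t) volume volume := fun t =>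
    measurePreserving_sub_right volume (r * t)
  rw [continuous_iff_continuousAt]
  intro t₀
  -- Translation is continuous in L²(ℝ), but p is square integrable only on right half-lines. For t
  -- < t₀ + 1 and x > 0 the point x - r t stays above the cut, so the truncation changes nothing
  -- near t₀.
  set P : Lp ℝ 2 (volume : Measure ℝ) := (h.memLp_indicator (-(r * (t₀ + 1)))).toLp _ with hP
  let g : ℝ → C(ℝ, ℝ) := fun t => ⟨fun x => x - r * t, by fun_prop⟩
  have hg : Continuous g := by
    apply ContinuousMap.continuous_of_continuous_uncurry
    simp only [g, Function.uncurry_def, ContinuousMap.coe_mk]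
    fun_prop
  have hc : Continuous fun t => LpToLpRestrictCLM ℝ ℝ ℝ volume 2 (Ioo 0 L)
      (Lp.compMeasurePreserving (g t) (hmp t) P) :=
    (LpToLpRestrictCLM ℝ ℝ ℝ volume 2 (Ioo 0 L)).continuous.comp
      ((continuous_const (y := P)).compMeasurePreservingLp hg hmp (by simp))
  refine hc.continuousAt.congr ?_
  filter_upwards [Iio_mem_nhds (lt_add_one t₀)] with t ht
  apply Lp.ext
  have e1 := LpToLpRestrictCLM_coeFn (p := 2) ℝ (Ioo 0 L)
    (Lp.compMeasurePreserving (g t) (hmp t) P)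
  have e2 := ae_restrict_of_ae (s := Ioo 0 L) (Lp.coeFn_compMeasurePreserving P (hmp t))
  have e3 := ae_restrict_of_ae (s := Ioo 0 L)
    ((hmp t).quasiMeasurePreserving.ae_eq_comp (h.memLp_indicator (-(r * (t₀ + 1)))).coeFn_toLp)
  filter_upwards [e1, e2, e3, h.coeFn_state_fst t, ae_restrict_mem measurableSet_Ioo]
    with x h1 h2 h3 h4 hx
  rw [h1, h4]
  refine h2.trans (h3.trans ?_)
  have : x - r * t ∈ Ioi (-(r * (t₀ + 1))) := by
    simp only [mem_Ioi]
    nlinarith [hx.1, mem_Iio.1 ht]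
  simp [Function.comp, indicator_of_mem this]

theorem continuous_state (h : IsProfile r L k p X) (hr : 0 < r) : Continuous h.state :=
  (WithLp.prod_continuous_toLp 2 _ _).comp ((h.continuous_state_fst hr).prodMk h.continuous)

/-- The shear (s, x) ↦ (s, x - r s) preserves the product measure, and on the strip in question only
the values of p on (-r t, L] occur. -/
theorem integrable_uncurry (h : IsProfile r L k p X) (hr : 0 < r) (t : ℝ) :
    Integrable (Function.uncurry fun s x => p (x - r * s))
      ((volume.restrict (Ioc 0 t)).prod (volume.restrict (Ioo 0 L))) := by
  set P : ℝ → ℝ := (Ioc (-(r * t)) L).indicator p with hP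
  have hPi : Integrable P volume := by
    rw [hP, integrable_indicator_iff measurableSet_Ioc]
    exact ((h.memLp (-(r * t))).mono_measure
      (Measure.restrict_mono Ioc_subset_Ioi_self le_rfl)).integrable one_le_two
  have h1 : Integrable (fun z : ℝ × ℝ => P z.2) ((volume.restrict (Ioc 0 t)).prod volume) :=
    hPi.comp_snd _
  have hskew : MeasurePreserving (fun z : ℝ × ℝ => (z.1, z.2 - r * z.1))
      ((volume.restrict (Ioc 0 t)).prod volume) ((volume.restrict (Ioc 0 t)).prod volume) :=
    (MeasurePreserving.id (volume.restrict (Ioc 0 t))).skew_product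
      (g := fun s x => x - r * s) (by simp only [Function.uncurry_def]; fun_prop)
      (ae_of_all _ fun s => (measurePreserving_sub_right volume (r * s)).map_eq)
  have h2 := hskew.integrable_comp_of_integrable h1
  have h3 : Integrable ((fun z : ℝ × ℝ => P z.2) ∘ fun z : ℝ × ℝ => (z.1, z.2 - r * z.1))
      ((volume.restrict (Ioc 0 t)).prod (volume.restrict (Ioo 0 L))) :=
    h2.mono_measure (Measure.prod_mono le_rfl Measure.restrict_le_self)
  refine h3.congr ?_
  rw [Measure.prod_restrict]
  filter_upwards [ae_restrict_mem (measurableSet_Ioc.prod measurableSet_Ioo)] with z hz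
  have hm : z.2 - r * z.1 ∈ Ioc (-(r * t)) L := by
    obtain ⟨⟨h1, h2⟩, h3, h4⟩ := hz
    constructor <;> nlinarith
  simp [hP, Function.uncurry_def, indicator_of_mem hm]

/-- The time integral of p(x - r s) over [0, t] is r⁻¹ times the integral of p over [x - r t, x]. It
is absolutely continuous in x with derivative r⁻¹ (p(x) - p(x - r t)), which is the required
difference of states up to the factor -r. Its values at x = 0 and x = L are the two remaining
`IsProfile` equations. -/
theorem generatorGraph (h : IsProfile r L k p X) (hr : 0 < r) (hL : 0 < L) {t : ℝ} (ht : 0 ≤ t) :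
    GeneratorGraph r L k (∫ s in (0 : ℝ)..t, h.state s) (h.state t - h.state 0) := by
  have hint : IntervalIntegrable h.state volume 0 t := (h.continuous_state hr).intervalIntegrable _ _
  have hfst : (∫ s in (0 : ℝ)..t, h.state s).fst = ∫ s in (0 : ℝ)..t, (h.state s).fst :=
    ((WithLp.fstL 2 ℝ (Lp ℝ 2 (volume.restrict (Ioo 0 L))) ℝ).intervalIntegral_comp_comm hint).symm
  have hsnd : (∫ s in (0 : ℝ)..t, h.state s).snd = ∫ s in (0 : ℝ)..t, X s :=
    ((WithLp.sndL 2 ℝ (Lp ℝ 2 (volume.restrict (Ioo 0 L))) ℝ).intervalIntegral_comp_comm hint).symm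
  set q : ℝ → ℝ := fun y => p y - p (y - r * t) with hq
  have hshift : ∀ a b, IntervalIntegrable (fun y => p (y - r * t)) volume a b := fun a b => by
    simpa using (h.intervalIntegrable (a - r * t) (b - r * t)).comp_sub_right (r * t)
  have hqi : ∀ a b, IntervalIntegrable q volume a b := fun a b =>
    (h.intervalIntegrable a b).sub (hshift a b)
  -- Written as a primitive of q plus a constant, so that absolute continuity and the derivative
  -- a.e. are immediate.
  set f : ℝ → ℝ := fun x => r⁻¹ * (∫ y in (0 : ℝ)..x, q y) + r⁻¹ * ∫ y in (-(r * t))..0, p y with hf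
  have hfeq : ∀ x, f x = ∫ s in (0 : ℝ)..t, p (x - r * s) := by
    intro x
    rw [intervalIntegral.integral_comp_sub_mul _ hr.ne', hf]
    simp only [hq, smul_eq_mul, mul_zero, sub_zero]
    rw [intervalIntegral.integral_sub (h.intervalIntegrable _ _) (hshift _ _),
      intervalIntegral.integral_comp_sub_right (fun y => p y), ← mul_add, zero_sub]
    congr 1
    have e1 := intervalIntegral.integral_add_adjacent_intervals
      (h.intervalIntegrable (-(r * t)) 0) (h.intervalIntegrable 0 x)
    have e2 := intervalIntegral.integral_add_adjacent_intervals
      (h.intervalIntegrable (-(r * t)) (x - r * t)) (h.intervalIntegrable (x - r * t) x)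
    linarith
  refine ⟨f, ?_, ?_, ?_, ?_, ?_⟩
  · exact (((hqi 0 L).absolutelyContinuousOnInterval_intervalIntegral (by simp)).const_mul r⁻¹).add
      (contDiffOn_const.absolutelyContinuousOnInterval)
  · rw [hfst, intervalIntegral.integral_of_le ht]
    have := coeFn_integral_ae_eq (ν := volume.restrict (Ioc 0 t))
      ((h.continuous_state_fst hr).integrableOn_Ioc) (h.integrable_uncurry hr t) h.coeFn_state_fst
    filter_upwards [this] with x hx
    rw [hx, hfeq, intervalIntegral.integral_of_le ht]
  · filter_upwards [h.coeFn_state_fst t, h.coeFn_state_fst 0,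
      Lp.coeFn_sub (h.state t).fst (h.state 0).fst,
      ae_restrict_of_ae (hqi 0 L).ae_hasDerivAt_integral, ae_restrict_mem measurableSet_Ioo]
      with x h1 h2 h3 h4 hx
    have hx' : x ∈ uIcc 0 L := by rw [uIcc_of_le hL.le]; exact Ioo_subset_Icc_self hx
    have hd := ((h4 hx' 0 (by simp)).const_mul r⁻¹).add_const (r⁻¹ * ∫ y in (-(r * t))..0, p y)
    rw [hd.deriv]
    simp only [WithLp.sub_fst, h3, Pi.sub_apply, h1, h2, hq]
    field_simp
    simp
  · rw [hfeq, hsnd, ← intervalIntegral.integral_const_mul]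
    apply intervalIntegral.integral_congr
    intro s hs
    rw [uIcc_of_le ht] at hs
    simp only [zero_sub]
    exact h.boundary s hs.1
  · rw [hfeq, WithLp.sub_snd, state_snd, state_snd, h.integral t ht]
    ring

theorem isSolution (h : IsProfile r L k p X) (hr : 0 < r) (hL : 0 < L) :
    IsSolution r L k (h.state 0) h.state :=
  ⟨(h.continuous_state hr).continuousOn, rfl, fun _ ht => h.generatorGraph hr hL ht⟩

end IsProfile

/-! ### Existence by the method of steps -/

/-- The profile with initial distribution `φ` and boundary data `-k X`. -/
noncomputable def boundaryProfile (r k : ℝ) (φ X : ℝ → ℝ) (y : ℝ) : ℝ :=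
  if 0 < y then φ y else -k * X (-y / r)

theorem memLp_boundaryProfile (r k : ℝ) {φ X : ℝ → ℝ} (hφ : MemLp φ 2 volume)
    (hX : Continuous X) (a : ℝ) :
    MemLp (boundaryProfile r k φ X) 2 (volume.restrict (Ioi a)) := by
  have hc : Continuous fun y : ℝ => -k * X (-y / r) := by fun_prop
  obtain ⟨C, hC⟩ := (isCompact_Icc (a := a) (b := 0)).exists_bound_of_continuousOn hc.continuousOn
  have h1 : MemLp ((Ioc a 0).indicator fun y : ℝ => -k * X (-y / r)) 2 volume := by
    rw [memLp_indicator_iff_restrict measurableSet_Ioc]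
    refine MemLp.of_bound hc.aestronglyMeasurable C ?_
    filter_upwards [ae_restrict_mem measurableSet_Ioc] with y hy
    exact hC y (Ioc_subset_Icc_self hy)
  refine (((hφ.indicator measurableSet_Ioi (s := Ioi 0)).add h1).restrict (Ioi a)).ae_eq ?_
  filter_upwards [ae_restrict_mem measurableSet_Ioi] with y hy
  rcases lt_or_ge 0 y with h | h
  · have : y ∉ Ioc a 0 := fun h' => absurd h'.2 (not_le.2 h)
    simp [boundaryProfile, h]
  · have h2 : y ∈ Ioc a 0 := ⟨hy, h⟩
    simp [boundaryProfile, h, not_lt.2 h, mem_Iio.1 hy]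

/-- This is the delay: the outflow at x = L up to time t depends on the integrator only up to time t
- L / r. -/
theorem boundaryProfile_congr {r k L t : ℝ} (hr : 0 < r) (φ : ℝ → ℝ) {X Y : ℝ → ℝ}
    (h : ∀ s ≤ t - L / r, X s = Y s) {s : ℝ} (hs : s ≤ t) :
    boundaryProfile r k φ X (L - r * s) = boundaryProfile r k φ Y (L - r * s) := by
  unfold boundaryProfile
  split_ifs
  · rfl
  · rw [h]
    have : -(L - r * s) / r = s - L / r := by field_simp; ring
    linarith

/-- The method of steps for the delay equation satisfied by the integrator state. -/
theorem exists_delay_solution {r L : ℝ} (k : ℝ) (hr : 0 < r) (hL : 0 < L) {φ : ℝ → ℝ}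
    (hφ : MemLp φ 2 volume) (ξ₀ : ℝ) :
    ∃ X : ℝ → ℝ, Continuous X ∧
      ∀ t, 0 ≤ t → X t = ξ₀ + ∫ s in (0 : ℝ)..t, boundaryProfile r k φ X (L - r * s) := by
  set τ := L / r with hτ
  have hτ0 : 0 < τ := div_pos hL hr
  -- Fixed points on [0, ∞) are the desired solutions. The cutoff `max t 0` keeps every iterate
  -- equal to ξ₀ at negative times.
  let step : (ℝ → ℝ) → ℝ → ℝ := fun X t =>
    ξ₀ + ∫ s in (0 : ℝ)..max t 0, boundaryProfile r k φ X (L - r * s)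
  let X : ℕ → ℝ → ℝ := fun n => step^[n] fun _ => ξ₀
  have hsucc : ∀ n, X (n + 1) = step (X n) := fun n => Function.iterate_succ_apply' _ _ _
  have hcont : ∀ n, Continuous (X n) := by
    intro n
    induction n with
    | zero => exact continuous_const
    | succ n ih =>
      rw [hsucc]
      have h1 := intervalIntegral.continuous_primitive
        (fun a b => intervalIntegrable_comp_sub_mul_of_memLp_Ioi
          (memLp_boundaryProfile r k hφ ih) r L a b) 0
      exact continuous_const.add (h1.comp (by fun_prop : Continuous fun t : ℝ => max t 0))
  have hstep : ∀ (Y Z : ℝ → ℝ) (t : ℝ), (∀ s ≤ max t 0 - τ, Y s = Z s) → step Y t = step Z t := by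
    intro Y Z t h
    simp only [step]
    congr 1
    apply intervalIntegral.integral_congr
    intro s hs
    rw [uIcc_of_le (le_max_right t 0)] at hs
    exact boundaryProfile_congr hr φ h hs.2
  -- Each iteration extends the interval of agreement by τ, so the n-th iterate is final up to time
  -- nτ.
  have hnext : ∀ n : ℕ, ∀ t ≤ n * τ, X (n + 1) t = X n t := by
    intro n
    induction n with
    | zero =>
      intro t ht
      have : max t 0 = 0 := max_eq_right (by simpa using ht)
      simp [X, step, this]
    | succ n ih =>
      intro t ht
      rw [hsucc (n + 1), hsucc n]
      apply hstep
      intro s hs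
      rw [← hsucc n]
      apply ih
      have : max t 0 ≤ (n + 1) * τ := max_le (by exact_mod_cast ht) (by positivity)
      linarith
  have hmono : ∀ n m : ℕ, n ≤ m → ∀ t ≤ n * τ, X m t = X n t := by
    intro n m hnm
    induction m, hnm using Nat.le_induction with
    | base => exact fun _ _ => rfl
    | succ m hm ih =>
      intro t ht
      rw [hnext m t (ht.trans (by gcongr)), ih t ht]
  have hceil : ∀ t : ℝ, t ≤ ⌈t / τ⌉₊ * τ := fun t => (div_le_iff₀ hτ0).1 (Nat.le_ceil _)
  have hlim : ∀ n : ℕ, ∀ t ≤ n * τ, X ⌈t / τ⌉₊ t = X n t := by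
    intro n t ht
    exact (hmono _ n (Nat.ceil_le.2 ((div_le_iff₀ hτ0).2 ht)) t (hceil t)).symm
  -- The iterates stabilise, so at time t it suffices to take the first one that is final there.
  refine ⟨fun t => X ⌈t / τ⌉₊ t, ?_, ?_⟩
  · rw [continuous_iff_continuousAt]
    intro t₀
    refine (hcont (⌈t₀ / τ⌉₊ + 1)).continuousAt.congr ?_
    have h1 : t₀ < (⌈t₀ / τ⌉₊ + 1) * τ := by linarith [hceil t₀]
    filter_upwards [Iio_mem_nhds h1] with t ht
    exact (hlim _ t (by push_cast; exact (mem_Iio.1 ht).le)).symm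
  · intro t ht
    set n := ⌈t / τ⌉₊
    have h1 : X n t = X (n + 1) t := (hnext n t (hceil t)).symm
    have h2 := hstep (X n) (fun t => X ⌈t / τ⌉₊ t) t fun s hs => by
      rw [max_eq_left ht] at hs
      exact (hlim n s (by linarith [hceil t])).symm
    rw [← hsucc] at h2
    refine (h1.trans h2).trans ?_
    simp only [step, max_eq_left ht]

theorem isProfile_boundaryProfile {r L k : ℝ} (hr : 0 < r) {φ X : ℝ → ℝ}
    (hφ : MemLp φ 2 volume) (hX : Continuous X)
    (h : ∀ t, 0 ≤ t → X t = X 0 + ∫ s in (0 : ℝ)..t, boundaryProfile r k φ X (L - r * s)) :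
    IsProfile r L k (boundaryProfile r k φ X) X where
  memLp := memLp_boundaryProfile r k hφ hX
  continuous := hX
  boundary t ht := by
    have h1 : ¬ 0 < -(r * t) := by nlinarith
    have h2 : -(-(r * t)) / r = t := by field_simp
    simp only [boundaryProfile, if_neg h1, h2]
  integral := h

theorem exists_isProfile {r L : ℝ} (k : ℝ) (hr : 0 < r) (hL : 0 < L) (z₀ : StateSpace L) :
    ∃ p X, ∃ h : IsProfile r L k p X, h.state 0 = z₀ := by
  set φ : ℝ → ℝ := (Ioo 0 L).indicator z₀.fst
  have hφ : MemLp φ 2 volume :=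
    (memLp_indicator_iff_restrict measurableSet_Ioo).2 (Lp.memLp z₀.fst)
  obtain ⟨X, hX, hint⟩ := exists_delay_solution k hr hL hφ z₀.snd
  have h0 : X 0 = z₀.snd := by simpa using hint 0 le_rfl
  have h := isProfile_boundaryProfile (L := L) (k := k) hr hφ hX fun t ht => by
    rw [h0]; exact hint t ht
  refine ⟨_, X, h, ?_⟩
  have hfst : (h.state 0).fst = z₀.fst := by
    apply Lp.ext
    filter_upwards [h.coeFn_state_fst 0, ae_restrict_mem measurableSet_Ioo] with x h1 hx
    rw [h1]
    simp [boundaryProfile, hx.1, φ, indicator_of_mem hx]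
  apply WithLp.ofLp_injective 2
  exact Prod.ext hfst h0

theorem wellPosed {r L : ℝ} (k : ℝ) (hr : 0 < r) (hL : 0 < L) : WellPosed r L k := by
  intro z₀
  refine ⟨?_, fun z₁ z₂ h₁ h₂ => h₁.eqOn hr hL h₂⟩
  obtain ⟨p, X, h, rfl⟩ := exists_isProfile k hr hL z₀
  exact ⟨h.state, h.isSolution hr hL⟩

/-! ### Spectrum of the delay operator -/

/-- By compactness of the spectrum the spectral radius is below 1. For q strictly between the two,
Gelfand's formula gives ‖aⁿ‖ ≤ qⁿ eventually, and C absorbs the finitely many exceptions. -/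
theorem exists_norm_pow_le_of_spectrum {A : Type*} [NormedRing A] [NormedAlgebra ℂ A]
    [CompleteSpace A] [Nontrivial A] (a : A) (h : ∀ z ∈ spectrum ℂ a, ‖z‖ < 1) :
    ∃ C > 0, ∃ q : ℝ, 0 < q ∧ q < 1 ∧ ∀ n : ℕ, ‖a ^ n‖ ≤ C * q ^ n := by
  have h1 : spectralRadius ℂ a < (1 : NNReal) :=
    spectrum.spectralRadius_lt_of_forall_lt a fun z hz => by
      rw [← NNReal.coe_lt_coe]; simpa using h z hz
  obtain ⟨q, hq1, hq2⟩ := ENNReal.lt_iff_exists_nnreal_btwn.1 h1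
  have hq0 : 0 < q := by
    have := lt_of_le_of_lt (zero_le (a := spectralRadius ℂ a)) hq1
    exact_mod_cast this
  have hev := (spectrum.pow_nnnorm_pow_one_div_tendsto_nhds_spectralRadius a).eventually
    (gt_mem_nhds hq1)
  have hO : (fun n : ℕ => a ^ n) =O[atTop] fun n : ℕ => (q : ℝ) ^ n := by
    refine Asymptotics.IsBigO.of_bound 1 ?_
    filter_upwards [hev, eventually_gt_atTop 0] with n hn hn0
    have hn0' : (0 : ℝ) < n := by exact_mod_cast hn0
    have h2 := ENNReal.rpow_le_rpow hn.le hn0'.le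
    rw [← ENNReal.rpow_mul, one_div, inv_mul_cancel₀ hn0'.ne', ENNReal.rpow_one,
      ENNReal.rpow_natCast] at h2
    have h3 : ‖a ^ n‖₊ ≤ q ^ n := by exact_mod_cast h2
    have h4 : ‖a ^ n‖ ≤ (q : ℝ) ^ n := by exact_mod_cast h3
    simpa using h4
  obtain ⟨C, hC, hb⟩ := Asymptotics.bound_of_isBigO_nat_atTop hO
  refine ⟨C, hC, q, by exact_mod_cast hq0, by exact_mod_cast hq2, fun n => ?_⟩
  have hqn : (0 : ℝ) < (q : ℝ) ^ n := pow_pos (by exact_mod_cast hq0) n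
  have := hb hqn.ne'
  rwa [Real.norm_of_nonneg hqn.le] at this

/-- The roots of `μ = exp (-c / μ)` lie in the open unit disc if `0 < c < π / 2`. -/
theorem norm_lt_one_of_eq_exp {c : ℝ} (hc0 : 0 < c) (hc : c < Real.pi / 2) {μ : ℂ}
    (h : μ = Complex.exp (-(c * μ⁻¹))) : ‖μ‖ < 1 := by
  by_contra! h1
  have hμ : μ ≠ 0 := by rw [h]; exact Complex.exp_ne_zero _
  -- If |μ| ≥ 1, taking moduli in the equation gives Re ν ≤ 0. But |c ν| < π/2 makes the cosine in
  -- Re μ positive, so Re μ > 0 and hence Re ν > 0, a contradiction.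
  set ν := μ⁻¹ with hν
  have hν1 : ‖ν‖ ≤ 1 := by rw [hν, norm_inv]; exact inv_le_one_of_one_le₀ h1
  have hre : ν.re ≤ 0 := by
    have h2 : ‖μ‖ = Real.exp (-(c * ν.re)) := by
      conv_lhs => rw [h]
      rw [Complex.norm_exp]
      simp
    rw [h2, Real.one_le_exp_iff] at h1
    nlinarith
  have him : |c * ν.im| < Real.pi / 2 := by
    rw [abs_mul, abs_of_pos hc0]
    nlinarith [Complex.abs_im_le_norm ν]
  have hμre : 0 < μ.re := by
    have h2 : μ.re = Real.exp (-(c * ν.re)) * Real.cos (-(c * ν.im)) := by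
      conv_lhs => rw [h]
      rw [Complex.exp_re]
      simp
    rw [h2, Real.cos_neg]
    have h3 := abs_lt.1 him
    exact mul_pos (Real.exp_pos _) (Real.cos_pos_of_mem_Ioo ⟨by linarith [h3.1], h3.2⟩)
  have hνre : 0 < ν.re := by
    rw [hν, Complex.inv_re]
    exact div_pos hμre (Complex.normSq_pos.2 hμ)
  linarith

section Delay

variable {τ : ℝ} (hτ : 0 ≤ τ)

theorem continuous_IccExtend_map (f : C(Icc 0 τ, ℂ)) : Continuous (IccExtend hτ f) :=
  f.continuous.Icc_extend'

/-- The Volterra operator `f ↦ (t ↦ ∫₀ᵗ f)` on `C([0, τ])`. -/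
noncomputable def volterra : C(Icc 0 τ, ℂ) →L[ℂ] C(Icc 0 τ, ℂ) :=
  LinearMap.mkContinuous
    { toFun := fun f => ⟨fun t => ∫ s in (0 : ℝ)..t, IccExtend hτ f s,
        (intervalIntegral.continuous_primitive
          (fun a b => (continuous_IccExtend_map hτ f).intervalIntegrable a b) 0).comp
          continuous_subtype_val⟩
      map_add' := fun f g => by
        ext t
        simp only [ContinuousMap.coe_mk, ContinuousMap.add_apply]
        rw [← intervalIntegral.integral_add
          ((continuous_IccExtend_map hτ f).intervalIntegrable _ _)
          ((continuous_IccExtend_map hτ g).intervalIntegrable _ _)]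
        rfl
      map_smul' := fun c f => by
        ext t
        simp only [ContinuousMap.coe_mk, ContinuousMap.smul_apply, RingHom.id_apply]
        rw [← intervalIntegral.integral_smul]
        rfl }
    τ fun f => by
      rw [ContinuousMap.norm_le _ (by positivity)]
      intro t
      have h1 : ∀ s ∈ uIoc (0 : ℝ) t, ‖IccExtend hτ f s‖ ≤ ‖f‖ := fun s _ => f.norm_coe_le_norm _
      refine (intervalIntegral.norm_integral_le_of_norm_le_const h1).trans ?_
      rw [sub_zero, abs_of_nonneg t.2.1, mul_comm]
      gcongr
      exact t.2.2

theorem volterra_apply (f : C(Icc 0 τ, ℂ)) (t : Icc 0 τ) :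
    volterra hτ f t = ∫ s in (0 : ℝ)..t, IccExtend hτ f s := rfl

/-- The solution operator of `x' (t) = -k x (t - τ)` over one delay interval, acting on segments
of solutions. -/
noncomputable def delayStep (k : ℂ) : C(Icc 0 τ, ℂ) →L[ℂ] C(Icc 0 τ, ℂ) :=
  (ContinuousMap.evalCLM ℂ (⟨τ, right_mem_Icc.2 hτ⟩ : Icc 0 τ)).smulRight
    (1 : C(Icc 0 τ, ℂ)) - k • volterra hτ

theorem delayStep_apply (k : ℂ) (f : C(Icc 0 τ, ℂ)) (t : Icc 0 τ) :
    delayStep hτ k f t =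
      f ⟨τ, right_mem_Icc.2 hτ⟩ - k * ∫ s in (0 : ℝ)..t, IccExtend hτ f s := by
  simp [delayStep, volterra_apply]

theorem hasDerivAt_cexp_mul_ofReal (c : ℂ) (t : ℝ) :
    HasDerivAt (fun t : ℝ => Complex.exp (c * t)) (Complex.exp (c * t) * c) t := by
  simpa using ((hasDerivAt_id (t : ℂ)).const_mul c).cexp.comp_ofReal

theorem hasDerivAt_integral_IccExtend (f : C(Icc 0 τ, ℂ)) (t : ℝ) :
    HasDerivAt (fun t : ℝ => ∫ s in (0 : ℝ)..t, IccExtend hτ f s) (IccExtend hτ f t) t :=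
  intervalIntegral.integral_hasDerivAt_right
    ((continuous_IccExtend_map hτ f).intervalIntegrable _ _)
    ((continuous_IccExtend_map hτ f).stronglyMeasurableAtFilter _ _)
    (continuous_IccExtend_map hτ f).continuousAt

/-- An eigenfunction satisfies μ f' = -k f and μ f(0) = f(τ), so exp(kt/μ) μ f(t) is constantly
f(τ). At t = τ this forces f(τ) = 0, hence f = 0, unless μ solves the characteristic equation. -/
theorem eq_zero_of_delayStep_eq {k μ : ℂ} (hμ : μ ≠ 0) (h : μ ≠ Complex.exp (-(k * τ * μ⁻¹)))
    {f : C(Icc 0 τ, ℂ)} (hf : delayStep hτ k f = μ • f) : f = 0 := by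
  set a := f ⟨τ, right_mem_Icc.2 hτ⟩ with ha
  set F : ℝ → ℂ := fun t => ∫ s in (0 : ℝ)..t, IccExtend hτ f s with hF
  have hfF : ∀ t : Icc 0 τ, μ * f t = a - k * F t := by
    intro t
    have := congrArg (fun g : C(Icc 0 τ, ℂ) => g t) hf
    simp only [delayStep_apply, ContinuousMap.smul_apply, smul_eq_mul] at this
    exact this.symm
  set G : ℝ → ℂ := fun t => Complex.exp (k * μ⁻¹ * t) * (a - k * F t) with hG
  have hGd : ∀ t : ℝ, HasDerivAt G (Complex.exp (k * μ⁻¹ * t) * (k * μ⁻¹) * (a - k * F t) +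
      Complex.exp (k * μ⁻¹ * t) * (-(k * IccExtend hτ f t))) t := fun t =>
    (hasDerivAt_cexp_mul_ofReal _ t).mul
      (((hasDerivAt_integral_IccExtend hτ f t).const_mul k).const_sub a)
  have hconst : ∀ t ∈ Icc 0 τ, G t = G 0 := by
    apply constant_of_has_deriv_right_zero
    · exact fun t _ => (hGd t).continuousAt.continuousWithinAt
    · intro t ht
      refine ((hGd t).congr_deriv ?_).hasDerivWithinAt
      have ht' : t ∈ Icc 0 τ := Ico_subset_Icc_self ht
      rw [IccExtend_of_mem hτ f ht', ← hfF ⟨t, ht'⟩]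
      field_simp
      ring
  have hsol : ∀ t : Icc 0 τ, Complex.exp (k * μ⁻¹ * t) * (μ * f t) = a := by
    intro t
    have h1 := hconst t t.2
    simp only [hG, hF, Complex.ofReal_zero, mul_zero, Complex.exp_zero,
      intervalIntegral.integral_same, sub_zero, one_mul] at h1
    rw [hfF t]
    exact h1
  have ha0 : a = 0 := by
    by_contra hne
    apply h
    have h1 := hsol ⟨τ, right_mem_Icc.2 hτ⟩
    rw [← ha, ← mul_assoc] at h1
    have h2 : Complex.exp (k * μ⁻¹ * τ) * μ = 1 := mul_right_cancel₀ hne (by rw [h1, one_mul])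
    rw [Complex.exp_neg]
    refine eq_inv_of_mul_eq_one_right ?_
    convert h2 using 3
    ring
  ext t
  have h1 := hsol t
  rw [ha0] at h1
  simpa [Complex.exp_ne_zero, hμ] using h1

/-- In terms of the primitive F of f the equation reads μ F' + k F = g with F(0) = 0, which
variation of constants solves. -/
theorem exists_smul_add_volterra_eq (k : ℂ) {μ : ℂ} (hμ : μ ≠ 0) (g : C(Icc 0 τ, ℂ)) :
    ∃ f : C(Icc 0 τ, ℂ), μ • f + k • volterra hτ f = g := by
  have hgc := continuous_IccExtend_map hτ g
  have hec : Continuous fun s : ℝ => Complex.exp (k * μ⁻¹ * s) * (μ⁻¹ * IccExtend hτ g s) := by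
    fun_prop
  set F : ℝ → ℂ := fun t => Complex.exp (-(k * μ⁻¹) * t) *
    ∫ s in (0 : ℝ)..t, Complex.exp (k * μ⁻¹ * s) * (μ⁻¹ * IccExtend hτ g s) with hF
  set fe : ℝ → ℂ := fun t => μ⁻¹ * (IccExtend hτ g t - k * F t) with hfe
  have hFd : ∀ t, HasDerivAt F (fe t) t := by
    intro t
    have h1 := (hasDerivAt_cexp_mul_ofReal (-(k * μ⁻¹)) t).mul
      (intervalIntegral.integral_hasDerivAt_right (hec.intervalIntegrable 0 t)
        (hec.stronglyMeasurableAtFilter _ _) hec.continuousAt)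
    refine h1.congr_deriv ?_
    have h2 : Complex.exp (-(k * μ⁻¹) * t) * Complex.exp (k * μ⁻¹ * t) = 1 := by
      rw [← Complex.exp_add]
      simp
    rw [← mul_assoc (Complex.exp (-(k * μ⁻¹) * t)) (Complex.exp (k * μ⁻¹ * t)), h2]
    simp only [hfe, hF]
    ring
  have hFc : Continuous F := continuous_iff_continuousAt.2 fun t => (hFd t).continuousAt
  have hfec : Continuous fe := by fun_prop
  refine ⟨⟨fun t => fe t, by fun_prop⟩, ?_⟩
  ext t
  have hint : ∫ s in (0 : ℝ)..t, IccExtend hτ (fun t : Icc 0 τ => fe t) s = F t := by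
    have h1 : ∫ s in (0 : ℝ)..t, IccExtend hτ (fun t : Icc 0 τ => fe t) s
        = ∫ s in (0 : ℝ)..t, fe s := by
      apply intervalIntegral.integral_congr
      intro s hs
      rw [uIcc_of_le t.2.1] at hs
      exact IccExtend_of_mem hτ (fun t : Icc 0 τ => fe t) ⟨hs.1, hs.2.trans t.2.2⟩
    rw [h1, intervalIntegral.integral_eq_sub_of_hasDerivAt (fun s _ => hFd s)
      (hfec.intervalIntegrable _ _)]
    simp [hF]
  simp only [ContinuousMap.add_apply, ContinuousMap.smul_apply, volterra_apply,
    ContinuousMap.coe_mk, smul_eq_mul, hint]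
  simp only [hfe, IccExtend_of_mem hτ g t.2]
  field_simp
  ring

/-- The operator is a rank-one perturbation of a multiple of the Volterra operator, so surjectivity
of μ minus it reduces to one scalar equation, which fails to be solvable only when there is an
eigenfunction. -/
theorem mem_spectrum_delayStep {k μ : ℂ} (hμ : μ ≠ 0)
    (h : μ ∈ spectrum ℂ (delayStep hτ k)) : μ = Complex.exp (-(k * τ * μ⁻¹)) := by
  by_contra hne
  rw [spectrum.mem_iff] at h
  apply h
  rw [ContinuousLinearMap.isUnit_iff_bijective]
  have happ : ∀ f, (algebraMap ℂ (C(Icc 0 τ, ℂ) →L[ℂ] C(Icc 0 τ, ℂ)) μ - delayStep hτ k) f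
      = μ • f - delayStep hτ k f := fun f => by
    simp [Algebra.algebraMap_eq_smul_one]
  constructor
  · rw [injective_iff_map_eq_zero]
    intro f hf
    rw [happ, sub_eq_zero] at hf
    exact eq_zero_of_delayStep_eq hτ hμ hne hf.symm
  · intro g
    set b : Icc 0 τ := ⟨τ, right_mem_Icc.2 hτ⟩ with hb
    obtain ⟨f₁, hf₁⟩ := exists_smul_add_volterra_eq hτ k hμ g
    obtain ⟨f₂, hf₂⟩ := exists_smul_add_volterra_eq hτ k hμ (1 : C(Icc 0 τ, ℂ))
    have hdef : ∀ f, delayStep hτ k f = f b • (1 : C(Icc 0 τ, ℂ)) - k • volterra hτ f :=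
      fun f => rfl
    have hb1 : f₂ b ≠ 1 := by
      intro h1
      have h2 : f₂ = 0 := by
        apply eq_zero_of_delayStep_eq hτ hμ hne (k := k)
        rw [hdef, h1, one_smul, ← hf₂]
        abel
      rw [h2] at h1
      simp at h1
    have hb2 : 1 - f₂ b ≠ 0 := sub_ne_zero.2 (Ne.symm hb1)
    -- The function f₁ + a f₂ solves the problem once a equals its own value at τ, that is a = f₁(τ)
    -- + a f₂(τ).
    set a : ℂ := f₁ b / (1 - f₂ b) with ha
    refine ⟨f₁ + a • f₂, ?_⟩
    have e : f₁ b + a * f₂ b = a := by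
      rw [ha]; field_simp; ring
    rw [happ, hdef]
    simp only [ContinuousMap.add_apply, ContinuousMap.smul_apply, smul_eq_mul, e, map_add, map_smul]
    rw [← hf₁]
    conv_lhs => rw [← hf₂]
    module

theorem exists_norm_delayStep_pow_le {k : ℝ} (hk : 0 < k * τ) (hk' : k * τ < Real.pi / 2) :
    ∃ C > 0, ∃ q : ℝ, 0 < q ∧ q < 1 ∧ ∀ n : ℕ, ‖delayStep hτ (k : ℂ) ^ n‖ ≤ C * q ^ n := by
  have : Nonempty (Icc 0 τ) := ⟨⟨0, left_mem_Icc.2 hτ⟩⟩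
  refine exists_norm_pow_le_of_spectrum (delayStep hτ (k : ℂ)) ?_
  intro μ hμ
  rcases eq_or_ne μ 0 with rfl | h0
  · simp
  · apply norm_lt_one_of_eq_exp hk hk'
    have := mem_spectrum_delayStep hτ h0 hμ
    push_cast
    exact this

end Delay

/-! ### Exponential decay of the trajectories -/

namespace IsProfile

variable {r L k : ℝ} {p X : ℝ → ℝ}

/-- What leaves at x = L after time L / r entered at x = 0 one transit time earlier; this is the
integrated delay equation. -/
theorem add_eq_sub_integral (h : IsProfile r L k p X) (hr : 0 < r) (hL : 0 < L) {t s : ℝ}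
    (ht : 0 ≤ t) (hs : 0 ≤ s) :
    X (t + L / r + s) = X (t + L / r) - k * ∫ u in (0 : ℝ)..s, X (t + u) := by
  have hτ : 0 < L / r := div_pos hL hr
  have hi := fun a b => intervalIntegrable_comp_sub_mul_of_memLp_Ioi h.memLp r L a b
  rw [h.integral (t + L / r + s) (by positivity), h.integral (t + L / r) (by positivity),
    ← intervalIntegral.integral_add_adjacent_intervals (hi 0 (t + L / r)) (hi _ _)]
  have e : ∫ u in (t + L / r)..(t + L / r + s), p (L - r * u)
      = ∫ u in (0 : ℝ)..s, -k * X (t + u) := by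
    have h1 := intervalIntegral.integral_comp_add_left (a := 0) (b := s)
      (fun u => p (L - r * u)) (t + L / r)
    rw [add_zero] at h1
    rw [← h1]
    apply intervalIntegral.integral_congr
    intro u hu
    rw [uIcc_of_le hs] at hu
    have h2 : L - r * (t + L / r + u) = -(r * (t + u)) := by field_simp; ring
    simp only [h2]
    exact h.boundary _ (add_nonneg ht hu.1)
  rw [e, intervalIntegral.integral_const_mul]
  ring

/-- The `n`-th segment of the integrator state. -/
noncomputable def segment (h : IsProfile r L k p X) (n : ℕ) : C(Icc 0 (L / r), ℂ) :=
  ⟨fun t => (X (n * (L / r) + t) : ℂ), by have := h.continuous; fun_prop⟩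

theorem segment_apply (h : IsProfile r L k p X) (n : ℕ) (t : Icc 0 (L / r)) :
    h.segment n t = (X (n * (L / r) + t) : ℂ) := rfl

theorem segment_succ (h : IsProfile r L k p X) (hr : 0 < r) (hL : 0 < L) (n : ℕ) :
    h.segment (n + 1) = delayStep (div_pos hL hr).le (k : ℂ) (h.segment n) := by
  have hτ : 0 < L / r := div_pos hL hr
  ext t
  rw [delayStep_apply]
  have e : ∫ s in (0 : ℝ)..t, IccExtend hτ.le (h.segment n) s
      = ((∫ s in (0 : ℝ)..t, X (n * (L / r) + s) : ℝ) : ℂ) := by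
    rw [← intervalIntegral.integral_ofReal]
    apply intervalIntegral.integral_congr
    intro s hs
    rw [uIcc_of_le t.2.1] at hs
    exact IccExtend_of_mem hτ.le (h.segment n) ⟨hs.1, hs.2.trans t.2.2⟩
  rw [e]
  simp only [segment_apply]
  have h1 := h.add_eq_sub_integral hr hL (t := n * (L / r)) (by positivity) t.2.1
  have h2 : ((n + 1 : ℕ) : ℝ) * (L / r) + t = n * (L / r) + L / r + t := by push_cast; ring
  rw [h2, h1]
  push_cast
  ring

theorem segment_eq_pow (h : IsProfile r L k p X) (hr : 0 < r) (hL : 0 < L) (n : ℕ) :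
    h.segment n = (delayStep (div_pos hL hr).le (k : ℂ) ^ n) (h.segment 0) := by
  induction n with
  | zero => simp
  | succ n ih =>
    rw [h.segment_succ hr hL, ih, pow_succ']
    rfl

theorem norm_state_fst_le (h : IsProfile r L k p X) (t : ℝ) :
    ‖(h.state t).fst‖ ≤ ‖h.state t‖ := by
  rw [← sq_le_sq₀ (norm_nonneg _) (norm_nonneg _), WithLp.prod_norm_sq_eq_of_L2]
  nlinarith [sq_nonneg ‖(h.state t).snd‖]

theorem abs_le_norm_state (h : IsProfile r L k p X) (t : ℝ) : |X t| ≤ ‖h.state t‖ := by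
  rw [← sq_le_sq₀ (abs_nonneg _) (norm_nonneg _), WithLp.prod_norm_sq_eq_of_L2, state_snd,
    Real.norm_eq_abs]
  nlinarith [sq_nonneg ‖(h.state t).fst‖]

/-- During the first transit the integrator accumulates only initial data, and Cauchy–Schwarz on (L
- r t, L) bounds it by the L² norm. This carries the Z norm into the sup norm of the first segment.
-/
theorem abs_le_of_mem_Icc (h : IsProfile r L k p X) (hr : 0 < r) {t : ℝ}
    (ht : t ∈ Icc 0 (L / r)) : |X t| ≤ (1 + r⁻¹ * √L) * ‖h.state 0‖ := by
  have hrt : r * t ≤ L := by have := (le_div_iff₀ hr).1 ht.2; linarith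
  have hrt0 : 0 ≤ r * t := mul_nonneg hr.le ht.1
  have hA : MeasurableSet (Ioo (L - r * t) L) := measurableSet_Ioo
  have hfin : (volume.restrict (Ioo 0 L)) (Ioo (L - r * t) L) ≠ ⊤ := measure_ne_top _ _
  have e : ∫ s in (0 : ℝ)..t, p (L - r * s)
      = r⁻¹ * inner ℝ (indicatorConstLp 2 hA hfin (1 : ℝ)) (h.state 0).fst := by
    rw [intervalIntegral.integral_comp_sub_mul _ hr.ne', mul_zero, sub_zero, smul_eq_mul,
      L2.inner_indicatorConstLp_one hA hfin,
      integral_congr_ae (ae_restrict_of_ae (h.coeFn_state_fst 0)),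
      Measure.restrict_restrict hA, Ioo_inter_Ioo, max_eq_left (by linarith), min_self,
      intervalIntegral.integral_of_le (by linarith), integral_Ioc_eq_integral_Ioo]
    simp
  have hind : ‖indicatorConstLp 2 hA hfin (1 : ℝ)‖ ≤ √L := by
    rw [norm_indicatorConstLp (by norm_num) (by norm_num), norm_one, one_mul, Real.sqrt_eq_rpow]
    norm_num
    apply Real.rpow_le_rpow measureReal_nonneg _ (by norm_num)
    rw [Ioo_inter_Ioo, max_eq_left (by linarith), min_self,
      Real.volume_real_Ioo_of_le (by linarith)]
    linarith
  rw [h.integral t ht.1, e]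
  have h1 : |inner ℝ (indicatorConstLp 2 hA hfin (1 : ℝ)) (h.state 0).fst| ≤
      √L * ‖h.state 0‖ :=
    (abs_real_inner_le_norm _ _).trans
      (mul_le_mul hind (h.norm_state_fst_le 0) (norm_nonneg _) (Real.sqrt_nonneg _))
  refine (abs_add_le _ _).trans ?_
  rw [abs_mul, abs_of_pos (inv_pos.2 hr), add_mul, one_mul, mul_assoc]
  gcongr
  exact h.abs_le_norm_state 0

/-- At time t the distributed state consists of boundary values -k X(s) with s in [t - L / r, t],
together with what remains of the initial distribution when t < L / r. -/
theorem norm_state_sq_le (h : IsProfile r L k p X) (hr : 0 < r) (hL : 0 < L) {t B : ℝ}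
    (ht : 0 ≤ t) (hB : ∀ s, 0 ≤ s → t - L / r ≤ s → |X s| ≤ B) :
    ‖h.state t‖ ^ 2 ≤ (if t < L / r then ‖h.state 0‖ ^ 2 else 0) + (L * k ^ 2 + 1) * B ^ 2 := by
  have hτ : 0 < L / r := div_pos hL hr
  have hX : X t ^ 2 ≤ B ^ 2 := by
    rw [← sq_abs]
    exact pow_le_pow_left₀ (abs_nonneg _) (hB t ht (by linarith)) 2
  have hrt : 0 ≤ r * t := mul_nonneg hr.le ht
  have hp : ∀ y, -(r * t) ≤ y → y ≤ L - r * t → y ≤ 0 → p y ^ 2 ≤ k ^ 2 * B ^ 2 := by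
    intro y h1 h2 h3
    have h4 : p y = -k * X (-y / r) := by
      have := h.boundary (-y / r) (div_nonneg (by linarith) hr.le)
      rwa [show -(r * (-y / r)) = y by field_simp] at this
    have h5 : |X (-y / r)| ≤ B := by
      apply hB _ (div_nonneg (by linarith) hr.le)
      rw [show t - L / r = (r * t - L) / r by field_simp]
      gcongr
      linarith
    rw [h4, mul_pow, neg_sq, ← sq_abs (X _)]
    gcongr
  have hi : ∀ a b, IntervalIntegrable (fun y => p y ^ 2) volume a b := by
    intro a b
    rw [intervalIntegrable_iff]
    have h1 : MemLp p 2 (volume.restrict (Ioc (min a b) (max a b))) :=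
      (h.memLp (min a b)).mono_measure (Measure.restrict_mono Ioc_subset_Ioi_self le_rfl)
    exact h1.integrable_sq
  have hle : ∀ a b, a ≤ b → -(r * t) ≤ a → b ≤ L - r * t → b ≤ 0 →
      ∫ y in a..b, p y ^ 2 ≤ L * k ^ 2 * B ^ 2 := by
    intro a b hab h1 h2 h3
    have h4 : ∫ y in a..b, p y ^ 2 ≤ ∫ _ in a..b, k ^ 2 * B ^ 2 :=
      intervalIntegral.integral_mono_on hab (hi _ _) intervalIntegrable_const
        fun y hy => hp y (h1.trans hy.1) (hy.2.trans h2) (hy.2.trans h3)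
    rw [intervalIntegral.integral_const, smul_eq_mul] at h4
    have h5 : (b - a) * (k ^ 2 * B ^ 2) ≤ L * (k ^ 2 * B ^ 2) := by
      gcongr
      linarith
    linarith
  have e : ∫ x in Ioo 0 L, p (x - r * t) ^ 2 = ∫ y in (-(r * t))..(L - r * t), p y ^ 2 := by
    rw [← integral_Ioc_eq_integral_Ioo, ← intervalIntegral.integral_of_le hL.le,
      intervalIntegral.integral_comp_sub_right (fun y => p y ^ 2), zero_sub]
  rw [h.norm_state_sq, e]
  split_ifs with hcase
  · have hrL : r * t < L := by have := (lt_div_iff₀ hr).1 hcase; linarith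
    rw [← intervalIntegral.integral_add_adjacent_intervals (hi _ 0) (hi _ _)]
    have h1 := hle (-(r * t)) 0 (by linarith) le_rfl (by linarith) le_rfl
    have h2 : ∫ y in (0 : ℝ)..(L - r * t), p y ^ 2 ≤ ‖h.state 0‖ ^ 2 := by
      have h3 : ∫ y in (0 : ℝ)..(L - r * t), p y ^ 2 ≤ ∫ y in (0 : ℝ)..L, p y ^ 2 :=
        intervalIntegral.integral_mono_interval le_rfl (by linarith) (by linarith)
          (ae_of_all _ fun y => sq_nonneg _) (hi _ _)
      refine h3.trans ?_
      rw [h.norm_state_sq, intervalIntegral.integral_of_le hL.le, integral_Ioc_eq_integral_Ioo]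
      simp only [mul_zero, sub_zero]
      linarith [sq_nonneg (X 0)]
    linarith
  · have hrL : L ≤ r * t := by have := (div_le_iff₀ hr).1 (not_lt.1 hcase); linarith
    have h1 := hle (-(r * t)) (L - r * t) (by linarith) le_rfl le_rfl (by linarith)
    linarith

end IsProfile

theorem exponentiallyStable {r L k : ℝ} (hr : 0 < r) (hL : 0 < L) (hk : 0 < k)
    (hk' : k < r * Real.pi / (2 * L)) : ExponentiallyStable r L k := by
  set τ := L / r with hτdef
  have hτ : 0 < τ := div_pos hL hr
  have hkτ : k * τ < Real.pi / 2 := by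
    rw [lt_div_iff₀ (by positivity)] at hk'
    rw [hτdef, mul_div_assoc', div_lt_iff₀ hr]
    linarith
  obtain ⟨C, hC, q, hq0, hq1, hpow⟩ :=
    exists_norm_delayStep_pow_le hτ.le (mul_pos hk hτ) hkτ
  set ω := -Real.log q / τ with hω
  have hω0 : 0 < ω := div_pos (by linarith [Real.log_neg hq0 hq1]) hτ
  have hqexp : ∀ n : ℕ, q ^ n = Real.exp (-ω * (n * τ)) := by
    intro n
    have : -ω * (n * τ) = n * Real.log q := by rw [hω]; field_simp
    rw [this, Real.exp_nat_mul, Real.exp_log hq0]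
  -- The factor exp(ωτ) pays for rounding t down to a multiple of τ.
  set K := C * (1 + r⁻¹ * √L) * Real.exp (ω * τ) with hK
  have hK0 : 0 < K := by positivity
  have hX : ∀ {p X : ℝ → ℝ} (h : IsProfile r L k p X) (t : ℝ), 0 ≤ t →
      |X t| ≤ K * Real.exp (-ω * t) * ‖h.state 0‖ := by
    intro p X h t ht
    set n := ⌊t / τ⌋₊ with hn
    have h1 : n * τ ≤ t := (le_div_iff₀ hτ).1 (Nat.floor_le (div_nonneg ht hτ.le))
    have h2 : t < (n + 1) * τ := (div_lt_iff₀ hτ).1 (Nat.lt_floor_add_one _)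
    have hmem : t - n * τ ∈ Icc 0 τ := ⟨by linarith, by linarith⟩
    have h3 : |X t| ≤ ‖h.segment n‖ := by
      have := (h.segment n).norm_coe_le_norm ⟨t - n * τ, hmem⟩
      rw [h.segment_apply, Complex.norm_real, Real.norm_eq_abs] at this
      simpa only [← hτdef, add_sub_cancel] using this
    have h4 : ‖h.segment 0‖ ≤ (1 + r⁻¹ * √L) * ‖h.state 0‖ := by
      rw [ContinuousMap.norm_le _ (by positivity)]
      intro s
      rw [h.segment_apply, Complex.norm_real, Real.norm_eq_abs]
      simpa using h.abs_le_of_mem_Icc hr s.2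
    have h5 : ‖h.segment n‖ ≤ C * q ^ n * ((1 + r⁻¹ * √L) * ‖h.state 0‖) := by
      rw [h.segment_eq_pow hr hL]
      exact (ContinuousLinearMap.le_opNorm _ _).trans
        (mul_le_mul (hpow n) h4 (norm_nonneg _) (by positivity))
    have h6 : q ^ n ≤ Real.exp (ω * τ) * Real.exp (-ω * t) := by
      rw [hqexp, ← Real.exp_add, Real.exp_le_exp]
      nlinarith
    calc |X t| ≤ C * q ^ n * ((1 + r⁻¹ * √L) * ‖h.state 0‖) := h3.trans h5
      _ ≤ C * (Real.exp (ω * τ) * Real.exp (-ω * t)) * ((1 + r⁻¹ * √L) * ‖h.state 0‖) := by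
        gcongr
      _ = K * Real.exp (-ω * t) * ‖h.state 0‖ := by rw [hK]; ring
  -- The squared exponential pays for looking back one delay. The summand 1 covers the remaining
  -- initial distribution, since E ≥ 1 for t < τ.
  set N := Real.exp (ω * τ) ^ 2 * (1 + (L * k ^ 2 + 1) * K ^ 2) with hN
  have hN0 : 0 < N := by positivity
  refine ⟨√N, Real.sqrt_pos.2 hN0, ω, hω0, ?_⟩
  intro z₀ z hz t ht
  obtain ⟨p, X, h, rfl⟩ := exists_isProfile k hr hL z₀
  rw [hz.eqOn hr hL (h.isSolution hr hL) (mem_Ici.2 ht)]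
  set E := Real.exp (ω * τ) * Real.exp (-ω * t) with hE
  have hB := h.norm_state_sq_le hr hL (t := t) (B := K * E * ‖h.state 0‖) ht
    (fun s hs hts => by
      refine (hX h s hs).trans ?_
      rw [hE, ← Real.exp_add]
      gcongr
      nlinarith)
  have hif : (if t < L / r then ‖h.state 0‖ ^ 2 else 0) ≤ E ^ 2 * ‖h.state 0‖ ^ 2 := by
    split_ifs with hc
    · have : 1 ≤ E := by
        rw [hE, ← Real.exp_add, Real.one_le_exp_iff]
        nlinarith
      exact le_mul_of_one_le_left (sq_nonneg _) (one_le_pow₀ this)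
    · positivity
  rw [← sq_le_sq₀ (norm_nonneg _) (by positivity), mul_pow, mul_pow, Real.sq_sqrt hN0.le]
  refine hB.trans ((add_le_add_left hif _).trans (le_of_eq ?_))
  rw [hN, hE]
  ring

/-! ### Unstable characteristic roots and failure of stability -/

/-- For `c ≥ π / 2` the characteristic equation `λ + c exp (-λ) = 0` has a root
`λ = a + i θ` in the closed right half-plane. -/
theorem exists_root_of_pi_div_two_le {c : ℝ} (hc : Real.pi / 2 ≤ c) :
    ∃ a θ : ℝ, 0 ≤ a ∧ a = -c * Real.exp (-a) * Real.cos θ ∧ θ = c * Real.exp (-a) * Real.sin θ := by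
  have hpi := Real.pi_pos
  -- Chosen so that cδ = π - 2δ ≤ π - δ, which gives g(π - δ) ≤ 0 below.
  set δ := Real.pi / (2 + c) with hδ
  have hc0 : 0 < c := by linarith
  have hδ0 : 0 < δ := by positivity
  have hδ1 : δ < Real.pi / 2 := by
    rw [hδ]
    gcongr
    linarith
  have hδc : δ * (2 + c) = Real.pi := by rw [hδ]; field_simp
  have hsin : ∀ θ ∈ Icc (Real.pi / 2) (Real.pi - δ), 0 < Real.sin θ := fun θ hθ =>
    Real.sin_pos_of_pos_of_lt_pi (by linarith [hθ.1]) (by linarith [hθ.2])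
  -- Dividing the two equations gives a = -θ cot θ; substituting this into the second one leaves
  -- g(θ) = 0.
  set g : ℝ → ℝ := fun θ => c * Real.sin θ * Real.exp (θ * Real.cos θ / Real.sin θ) - θ with hg
  have hgc : ContinuousOn g (Icc (Real.pi / 2) (Real.pi - δ)) := by
    have : ContinuousOn (fun θ : ℝ => θ * Real.cos θ / Real.sin θ)
        (Icc (Real.pi / 2) (Real.pi - δ)) :=
      ContinuousOn.div (by fun_prop) (by fun_prop) fun θ hθ => (hsin θ hθ).ne'
    fun_prop
  have hg0 : 0 ≤ g (Real.pi / 2) := by simp [hg]; linarith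
  have hcos : ∀ θ ∈ Icc (Real.pi / 2) (Real.pi - δ), θ * Real.cos θ / Real.sin θ ≤ 0 := by
    intro θ hθ
    have h1 : Real.cos θ ≤ 0 := Real.cos_nonpos_of_pi_div_two_le_of_le hθ.1 (by linarith [hθ.2])
    exact div_nonpos_of_nonpos_of_nonneg
      (mul_nonpos_of_nonneg_of_nonpos (by linarith [hθ.1]) h1) (hsin θ hθ).le
  have hle : Real.pi / 2 ≤ Real.pi - δ := by linarith
  have hg1 : g (Real.pi - δ) ≤ 0 := by
    have hm : Real.pi - δ ∈ Icc (Real.pi / 2) (Real.pi - δ) := right_mem_Icc.2 hle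
    have h1 := Real.exp_le_one_iff.2 (hcos _ hm)
    have h2 : Real.sin (Real.pi - δ) ≤ δ := by rw [Real.sin_pi_sub]; exact Real.sin_le hδ0.le
    have h3 : c * Real.sin (Real.pi - δ) *
        Real.exp ((Real.pi - δ) * Real.cos (Real.pi - δ) / Real.sin (Real.pi - δ)) ≤
        c * Real.sin (Real.pi - δ) * 1 :=
      mul_le_mul_of_nonneg_left h1 (mul_nonneg hc0.le (hsin _ hm).le)
    simp only [hg]
    nlinarith
  obtain ⟨θ, hθ, hθ0⟩ := intermediate_value_Icc' hle hgc ⟨hg1, hg0⟩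
  have hs := hsin θ hθ
  have hroot : c * Real.sin θ * Real.exp (θ * Real.cos θ / Real.sin θ) = θ := sub_eq_zero.1 hθ0
  refine ⟨-(θ * Real.cos θ / Real.sin θ), θ, by linarith [hcos θ hθ], ?_, ?_⟩
  · rw [neg_neg, ← neg_div, div_eq_iff hs.ne']
    linear_combination Real.cos θ * hroot
  · rw [neg_neg]
    linarith

/-- For `k ≤ 0` the characteristic equation `λ + k exp (-λ τ) = 0` has a nonnegative real root. -/
theorem exists_root_of_nonpos {k τ : ℝ} (hk : k ≤ 0) (hτ : 0 ≤ τ) :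
    ∃ a : ℝ, 0 ≤ a ∧ a = -k * Real.exp (-(a * τ)) := by
  set g : ℝ → ℝ := fun a => a + k * Real.exp (-(a * τ)) with hg
  have hgc : Continuous g := by fun_prop
  have h0 : g 0 ≤ 0 := by simpa [hg] using hk
  have h1 : 0 ≤ g (-k) := by
    have : Real.exp (-(-k * τ)) ≤ 1 := Real.exp_le_one_iff.2 (by nlinarith)
    simp only [hg]
    nlinarith
  obtain ⟨a, ha, ha0⟩ := intermediate_value_Icc (neg_nonneg.2 hk) hgc.continuousOn ⟨h0, h1⟩
  refine ⟨a, ha.1, ?_⟩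
  simp only [hg] at ha0
  linarith

theorem exists_root_of_notMem {k τ : ℝ} (hτ : 0 < τ) (h : k ≤ 0 ∨ Real.pi / 2 ≤ k * τ) :
    ∃ a b : ℝ, 0 ≤ a ∧ a = -k * Real.exp (-(a * τ)) * Real.cos (b * τ) ∧
      b = k * Real.exp (-(a * τ)) * Real.sin (b * τ) := by
  rcases h with hk | hk
  · obtain ⟨a, ha, h⟩ := exists_root_of_nonpos hk hτ.le
    exact ⟨a, 0, ha, by simpa using h, by simp⟩
  · obtain ⟨a, θ, ha, h1, h2⟩ := exists_root_of_pi_div_two_le hk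
    -- Rescaling time by τ turns the root for c = kτ and unit delay into one for delay τ.
    refine ⟨a / τ, θ / τ, by positivity, ?_, ?_⟩
    · rw [div_mul_cancel₀ _ hτ.ne', div_mul_cancel₀ _ hτ.ne', div_eq_iff hτ.ne']
      linarith
    · rw [div_mul_cancel₀ _ hτ.ne', div_mul_cancel₀ _ hτ.ne', div_eq_iff hτ.ne']
      linarith

/-- A root of the characteristic equation yields an oscillating solution. -/
theorem exists_isProfile_exp_mul_cos {r L k a b : ℝ} (hr : 0 < r)
    (ha : a = -k * Real.exp (-(a * (L / r))) * Real.cos (b * (L / r)))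
    (hb : b = k * Real.exp (-(a * (L / r))) * Real.sin (b * (L / r))) :
    ∃ p, IsProfile r L k p fun t => Real.exp (a * t) * Real.cos (b * t) := by
  set X : ℝ → ℝ := fun t => Real.exp (a * t) * Real.cos (b * t) with hX
  have hXc : Continuous X := by fun_prop
  set ψ : ℝ → ℝ := fun y => -k * X (-y / r) with hψ
  have hψc : Continuous ψ := by fun_prop
  -- The initial distribution continues the boundary formula to negative times, so the delay
  -- equation holds from time 0 on.
  set φ : ℝ → ℝ := (Ioc 0 L).indicator ψ with hφ
  have hφm : MemLp φ 2 volume := by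
    obtain ⟨C, hC⟩ := (isCompact_Icc (a := 0) (b := L)).exists_bound_of_continuousOn hψc.continuousOn
    rw [hφ, memLp_indicator_iff_restrict measurableSet_Ioc]
    refine MemLp.of_bound hψc.aestronglyMeasurable C ?_
    filter_upwards [ae_restrict_mem measurableSet_Ioc] with y hy
    exact hC y (Ioc_subset_Icc_self hy)
  refine ⟨_, isProfile_boundaryProfile hr hφm hXc ?_⟩
  intro t ht
  have hd : ∀ s, HasDerivAt X (-k * X (s - L / r)) s := by
    intro s
    have h1 : HasDerivAt (fun s => Real.exp (a * s)) (Real.exp (a * s) * a) s := by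
      simpa using ((hasDerivAt_id s).const_mul a).exp
    have h2 : HasDerivAt (fun s => Real.cos (b * s)) (-Real.sin (b * s) * b) s := by
      simpa using ((hasDerivAt_id s).const_mul b).cos
    refine (h1.mul h2).congr_deriv ?_
    simp only [hX, mul_sub, Real.cos_sub]
    rw [sub_eq_add_neg (a * s), Real.exp_add]
    set e := Real.exp (-(a * (L / r)))
    set co := Real.cos (b * (L / r))
    set si := Real.sin (b * (L / r))
    linear_combination Real.exp (a * s) * Real.cos (b * s) * ha -
      Real.exp (a * s) * Real.sin (b * s) * hb
  have e : ∫ s in (0 : ℝ)..t, boundaryProfile r k φ X (L - r * s)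
      = ∫ s in (0 : ℝ)..t, -k * X (s - L / r) := by
    apply intervalIntegral.integral_congr
    intro s hs
    rw [uIcc_of_le ht] at hs
    have h1 : -(L - r * s) / r = s - L / r := by field_simp; ring
    have h2 : L - r * s ≤ L := by nlinarith [hs.1]
    simp only [boundaryProfile, h1]
    split_ifs with h0
    · rw [hφ, indicator_of_mem (show L - r * s ∈ Ioc 0 L from ⟨h0, h2⟩), hψ]
      simp only [h1]
    · rfl
  rw [e, intervalIntegral.integral_eq_sub_of_hasDerivAt (fun s _ => hd s)
    (Continuous.intervalIntegrable (by fun_prop) _ _)]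
  ring

theorem exists_period (b : ℝ) : ∃ T : ℝ, 0 < T ∧ ∀ n : ℕ, Real.cos (b * (n * T)) = 1 := by
  rcases eq_or_ne b 0 with rfl | hb
  · exact ⟨1, one_pos, by simp⟩
  · refine ⟨2 * Real.pi / |b|, by positivity, fun n => ?_⟩
    have h1 : |b * (n * (2 * Real.pi / |b|))| = n * (2 * Real.pi) := by
      have : 0 ≤ n * (2 * Real.pi / |b|) := by positivity
      rw [abs_mul, abs_of_nonneg this]
      field_simp
    rw [← Real.cos_abs, h1, Real.cos_nat_mul_two_pi]

/-- At the times nT where the cosine equals 1, the integrator is exp(a n T) ≥ 1, which no decaying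
bound allows. -/
theorem not_exponentiallyStable {r L k : ℝ} (hr : 0 < r) (hL : 0 < L)
    (h : k ≤ 0 ∨ Real.pi / 2 ≤ k * (L / r)) : ¬ ExponentiallyStable r L k := by
  rintro ⟨M, hM, ω, hω, hst⟩
  obtain ⟨a, b, ha0, ha, hb⟩ := exists_root_of_notMem (div_pos hL hr) h
  obtain ⟨p, hp⟩ := exists_isProfile_exp_mul_cos hr ha hb
  obtain ⟨T, hT, hcos⟩ := exists_period b
  have hle : ∀ n : ℕ, 1 ≤ M * Real.exp (-ω * (n * T)) * ‖hp.state 0‖ := by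
    intro n
    have hnT : 0 ≤ n * T := by positivity
    have h1 := hst _ _ (hp.isSolution hr hL) (n * T) hnT
    have h2 : |Real.exp (a * (n * T)) * Real.cos (b * (n * T))| ≤ ‖hp.state (n * T)‖ :=
      hp.abs_le_norm_state (n * T)
    rw [hcos n, mul_one, Real.abs_exp] at h2
    have h3 : 1 ≤ Real.exp (a * (n * T)) := Real.one_le_exp (by positivity)
    linarith
  have hlim : Tendsto (fun n : ℕ => M * Real.exp (-ω * (n * T)) * ‖hp.state 0‖) atTop (𝓝 0) := by
    have h1 : Tendsto (fun n : ℕ => ω * (n * T)) atTop atTop :=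
      (tendsto_natCast_atTop_atTop.atTop_mul_const hT).const_mul_atTop hω
    have h2 := Real.tendsto_exp_neg_atTop_nhds_zero.comp h1
    have h3 := (h2.const_mul M).mul_const ‖hp.state 0‖
    simpa [Function.comp_def] using h3
  have := ge_of_tendsto' hlim hle
  linarith

end TransportIntegral

theorem proposition1 (r L : ℝ) (hr : 0 < r) (hL : 0 < L) (k_I : ℝ) :
    TransportIntegral.WellPosed r L k_I ∧
      (TransportIntegral.ExponentiallyStable r L k_I ↔
        k_I ∈ Set.Ioo 0 (r * Real.pi / (2 * L))) := by
  refine ⟨TransportIntegral.wellPosed k_I hr hL, fun h => ?_,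
    fun h => TransportIntegral.exponentiallyStable hr hL h.1 h.2⟩
  by_contra hk
  refine TransportIntegral.not_exponentiallyStable hr hL ?_ h
  rw [Set.mem_Ioo, not_and_or, not_lt, not_lt] at hk
  refine hk.imp_right fun hk => ?_
  rw [div_le_iff₀ (by positivity)] at hk
  rw [mul_div_assoc', le_div_iff₀ hr]
  linarith
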